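/- Let $N\ge 1$, $d\ge 0$, let $\mathcal G$ be a connected undirected simple graph on $\{1,\dots,N\}$ with adjacency matrix $[a_{ij}]$, $a_{ij}\in\{0,1\}$, and let $f^1,\dots,f^N:\mathbb R^d\to\mathbb R$ be twice differentiable and strongly convex, with gradients $g^i=\nabla f^i$ and Hessians $H^i=\nabla^2 f^i$ satisfying $\underline m^i I\preceq H^i(x)\preceq \overline m^i I$ for all $x\in\mathbb R^d$, for some $\underline m^i,\overline m^i>0$. Consider, for $i=1,\dots,N$, the dynamics \[ z^i=g^i(x^i)+v^i,\qquad \dot v^i=-\sum_{j=1}^N a_{ij}\,\mathrm{sgn}(z^i-z^j)+\sum_{j=1}^N a_{ij}(x^i-x^j),\qquad \dot x^i=-H^i(x^i)^{-1}\Big(z^i+\sum_{j=1}^N a_{ij}(x^i-x^j)\Big), \] where $\mathrm{sgn}$ acts componentwise. A solution is understood in the sense of Filippov: $x=(x^i)_i$ and $v=(v^i)_i$ are defined on $[0,\infty)$ and absolutely continuous on compact intervals, and for almost every $t$ the equation for $\dot x$ holds and the equation for $\dot v$ holds with the discontinuous map $\Phi(z)=\big(\sum_j a_{ij}\,\mathrm{sgn}(z^i-z^j)\big)_{i}$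 at $z(t)$ replaced by some element of its Filippov regularization $\bigcap_{\delta>0}\bigcap_{\mu(S)=0}\overline{\mathrm{co}}\,\Phi(B(z(t),\delta)\setminus S)$, $\mu$ being Lebesgue measure on $(\mathbb R^d)^N$. Let $x^i_0,v^i_0\in\mathbb R^d$ be arbitrary with $\sum_{i=1}^N v^i_0=0$. Then there is a finite time $T\ge 0$ such that for every solution with $x^i(0)=x^i_0$, $v^i(0)=v^i_0$ for all $i$: \[ z^i(t)=\frac1N\sum_{j=1}^N g^j(x^j(t))\quad\text{for all } t\ge T \text{ and all } i, \qquad\text{and}\qquad \lim_{t\to\infty}\Big(x^i(t)-\frac1N\sum_{j=1}^N x^j(t)\Big)=0\quad\text{for all } i . \] -/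

import Mathlib

open MeasureTheory Filter Topology

noncomputable section

namespace HISO

/-- Filippov's set-valued regularization of a (possibly discontinuous) map `F` at `y`:
`⋂_{δ > 0} ⋂_{μ(S) = 0} closure (conv F(B(y, δ) \ S))`, where `μ` is Lebesgue measure. -/
def filippovMap {E G : Type*} [PseudoMetricSpace E] [MeasureSpace E]
    [NormedAddCommGroup G] [NormedSpace ℝ G] (F : E → G) (y : E) : Set G :=
  ⋂ (δ : ℝ) (_ : 0 < δ) (S : Set E) (_ : volume S = 0),
    closure (convexHull ℝ (F '' (Metric.ball y δ \ S)))

/-- The decision space `ℝ^d` of one agent. -/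
abbrev Vec (d : ℕ) : Type := EuclideanSpace ℝ (Fin d)

/-- A network-aggregated variable: one vector of `ℝ^d` for each of the `N` agents. -/
abbrev Net (N d : ℕ) : Type := Fin N → Vec d

/-- The componentwise sign of a vector (with `sgn 0 = 0`). -/
def sgn {d : ℕ} (u : Vec d) : Vec d := WithLp.toLp 2 (fun k => Real.sign (u k))

/-- The Hessian of `f` at `x`, as a linear map: the derivative of the gradient. -/
def hessian {d : ℕ} (f : Vec d → ℝ) (x : Vec d) : Vec d →L[ℝ] Vec d :=
  fderiv ℝ (gradient f) x

/-- The standing assumption on a local cost: it is twice differentiable and strongly convex,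
and its Hessian lies between two positive multiples of the identity. -/
structure IsAdmissibleCost {d : ℕ} (f : Vec d → ℝ) : Prop where
  differentiable : Differentiable ℝ f
  differentiable_gradient : Differentiable ℝ (gradient f)
  strongConvex : ∃ m : ℝ, 0 < m ∧ StrongConvexOn Set.univ m f
  hessian_bounds : ∃ mlo mhi : ℝ, 0 < mlo ∧ 0 < mhi ∧ ∀ x y : Vec d,
    mlo * ‖y‖ ^ 2 ≤ inner ℝ y (hessian f x y) ∧ inner ℝ y (hessian f x y) ≤ mhi * ‖y‖ ^ 2

variable {N d : ℕ}

/-- The sign coupling: the `i`-th block is `∑ j, a_ij sgn(z^i - z^j)`. -/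
def signCoupling (G : SimpleGraph (Fin N)) [DecidableRel G.Adj] (z : Net N d) : Net N d :=
  fun i => ∑ j, G.adjMatrix ℝ i j • sgn (z i - z j)

/-- The linear coupling: the `i`-th block is `∑ j, a_ij (x^i - x^j)`. -/
def linearCoupling (G : SimpleGraph (Fin N)) [DecidableRel G.Adj] (x : Net N d) : Net N d :=
  fun i => ∑ j, G.adjMatrix ℝ i j • (x i - x j)

/-- The agents' outputs `z^i = g^i(x^i) + v^i`, with `g^i = ∇ f^i`. -/
def output (f : Fin N → Vec d → ℝ) (x v : Net N d) : Net N d :=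
  fun i => gradient (f i) (x i) + v i

/-- `t ↦ (x t, v t)` is, on `[0, ∞)`, a solution in the sense of Filippov of the distributed HISO
dynamics
`z^i = ∇f^i(x^i) + v^i`,
`v̇^i = -∑ j, a_ij sgn(z^i - z^j) + ∑ j, a_ij (x^i - x^j)`,
`ẋ^i = -H^i(x^i)⁻¹ (z^i + ∑ j, a_ij (x^i - x^j))`:
the functions are absolutely continuous on compact intervals, and the equations hold for almost
every time, with the discontinuous sign coupling replaced by its Filippov regularization. (When
the Hessians are continuous this is the same as regularizing the whole vector field in `(x, v)`,
because the remaining terms are continuous and `(x, v) ↦ (x, z)` is a bi-Lipschitz change of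
variables.) -/
structure IsSolution (G : SimpleGraph (Fin N)) [DecidableRel G.Adj] (f : Fin N → Vec d → ℝ)
    (x v : ℝ → Net N d) : Prop where
  absolutelyContinuous_x : ∀ T : ℝ, 0 ≤ T → AbsolutelyContinuousOnInterval x 0 T
  absolutelyContinuous_v : ∀ T : ℝ, 0 ≤ T → AbsolutelyContinuousOnInterval v 0 T
  ode_x : ∀ᵐ t : ℝ, 0 < t → HasDerivAt x (fun i => -((hessian (f i) (x t i)).inverse
    (output f (x t) (v t) i + linearCoupling G (x t) i))) t
  ode_v : ∀ᵐ t : ℝ, 0 < t → ∃ s ∈ filippovMap (signCoupling (d := d) G) (output f (x t) (v t)),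
    HasDerivAt v (fun i => -(s i) + linearCoupling G (x t) i) t

end HISO

end

/-! ### Absolutely continuous functions and differential inequalities -/

namespace AbsolutelyContinuousOnInterval

/-! Differentiating `z^i = ∇f^i(x^i) + v^i` makes the Hessian cancel its inverse and the two linear
couplings cancel each other, so `ż = -z - s` with `s` in the Filippov set: the outputs no longer see
`x`. Every such `s` has block sum zero and the same pairing with `z`, the edge variation
(`sum_of_mem_filippovMap`, `sum_inner_of_mem_filippovMap`), so no selection or uniqueness is needed.
On a connected graph this variation dominates the square root of the disagreement `D`, hence `D' ≤
-c √D` and `D` vanishes after a time fixed by the initial data. Since `∑ v^i` stays zero, the common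
output is the mean gradient.

The decisions follow a preconditioned descent of the Dirichlet energy, perturbed by `z`.
Cocoercivity of the Hessians bounds the perturbation by a multiple of `∑ ‖z^i‖²`, which itself
decays; energy plus a multiple of that sum is a strict Lyapunov function by a Poincaré inequality.
-/

theorem lipschitzOnWith_comp {X Y : Type*} [PseudoMetricSpace X] [PseudoMetricSpace Y]
    {f : ℝ → X} {φ : X → Y} {a b : ℝ} {K : NNReal} (hf : AbsolutelyContinuousOnInterval f a b)
    (hφ : LipschitzOnWith K φ (f '' Set.uIcc a b)) :
    AbsolutelyContinuousOnInterval (fun t => φ (f t)) a b := by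
  rw [absolutelyContinuousOnInterval_iff] at hf ⊢
  intro ε hε
  obtain ⟨δ, hδ, H⟩ := hf (ε / (K + 1)) (by positivity)
  refine ⟨δ, hδ, fun E hE hlen => ?_⟩
  calc ∑ i ∈ Finset.range E.1, dist (φ (f (E.2 i).1)) (φ (f (E.2 i).2))
      ≤ ∑ i ∈ Finset.range E.1, K * dist (f (E.2 i).1) (f (E.2 i).2) := by
        refine Finset.sum_le_sum fun i hi => ?_
        have := hE.1 i hi
        exact hφ.dist_le_mul _ (Set.mem_image_of_mem _ this.1) _ (Set.mem_image_of_mem _ this.2)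
    _ = K * ∑ i ∈ Finset.range E.1, dist (f (E.2 i).1) (f (E.2 i).2) := by
        rw [Finset.mul_sum]
    _ ≤ K * (ε / (K + 1)) := by
        gcongr
        exact (H E hE hlen).le
    _ < ε := by
        rw [mul_div_assoc', div_lt_iff₀ (by positivity)]
        nlinarith

/-- The curve stays in a compact ball, where a `C¹` map is Lipschitz. Quadratic Lyapunov functions
are not globally Lipschitz. -/
theorem contDiff_comp {E F : Type*} [NormedAddCommGroup E] [NormedSpace ℝ E]
    [FiniteDimensional ℝ E] [NormedAddCommGroup F] [NormedSpace ℝ F]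
    {f : ℝ → E} {φ : E → F} {a b : ℝ} (hf : AbsolutelyContinuousOnInterval f a b)
    (hφ : ContDiff ℝ 1 φ) : AbsolutelyContinuousOnInterval (fun t => φ (f t)) a b := by
  obtain ⟨C, hC⟩ := hf.exists_bound
  obtain ⟨K, hK⟩ := (hφ.contDiffOn (s := Metric.closedBall 0 C)).exists_lipschitzOnWith
    (by decide) (convex_closedBall _ _) (isCompact_closedBall _ _)
  refine hf.lipschitzOnWith_comp (hK.mono ?_)
  rintro _ ⟨t, ht, rfl⟩
  simpa using hC t ht

theorem sub_le_of_hasDerivAt_le {u : ℝ → ℝ} {a b c : ℝ} (hab : a ≤ b)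
    (hu : AbsolutelyContinuousOnInterval u a b)
    (h : ∀ᵐ t : ℝ, t ∈ Set.Ioo a b → ∃ u', HasDerivAt u u' t ∧ u' ≤ c) :
    u b - u a ≤ c * (b - a) := by
  rw [← hu.integral_deriv_eq_sub]
  have : ∫ _ in a..b, c = c * (b - a) := by
    rw [intervalIntegral.integral_const, smul_eq_mul, mul_comm]
  rw [← this]
  refine intervalIntegral.integral_mono_ae_restrict hab hu.intervalIntegrable_deriv (by simp) ?_
  rw [← Measure.restrict_congr_set Ioo_ae_eq_Icc]
  refine (ae_restrict_iff' measurableSet_Ioo).2 ?_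
  filter_upwards [h] with t ht hmem
  obtain ⟨u', h1, h2⟩ := ht hmem
  rwa [h1.deriv]

theorem antitoneOn_of_hasDerivAt_nonpos {u : ℝ → ℝ} {a b : ℝ}
    (hu : AbsolutelyContinuousOnInterval u a b)
    (h : ∀ᵐ t : ℝ, t ∈ Set.Ioo a b → ∃ u', HasDerivAt u u' t ∧ u' ≤ 0) :
    AntitoneOn u (Set.Icc a b) := by
  intro s hs t ht hst
  have := sub_le_of_hasDerivAt_le hst
    (hu.mono (Set.uIcc_subset_uIcc (Set.Icc_subset_uIcc hs) (Set.Icc_subset_uIcc ht)))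
    (c := 0) (by
      filter_upwards [h] with r hr hmem
      exact hr ⟨hs.1.trans_lt hmem.1, hmem.2.trans_le ht.2⟩)
  linarith

/-- A nonnegative function with `u' ≤ -c √u` vanishes after the finite time `2 √u(0) / c`. -/
theorem eq_zero_of_hasDerivAt_le_neg_sqrt {u : ℝ → ℝ} {c T : ℝ} (hc : 0 < c) (hT : 0 ≤ T)
    (hu : AbsolutelyContinuousOnInterval u 0 T) (hpos : ∀ t, 0 ≤ u t)
    (h : ∀ᵐ t : ℝ, t ∈ Set.Ioo 0 T → ∃ u', HasDerivAt u u' t ∧ u' ≤ -c * √(u t))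
    (hT' : 2 * √(u 0) / c ≤ T) : u T = 0 := by
  -- If `u T > 0`, monotonicity keeps `u` away from `0` on the whole interval; there `√` is
  -- Lipschitz, so `√u` is absolutely continuous with slope at most `-c/2`.
  by_contra hne
  have hTpos : 0 < u T := lt_of_le_of_ne (hpos T) (Ne.symm hne)
  have hanti : AntitoneOn u (Set.Icc 0 T) := by
    refine hu.antitoneOn_of_hasDerivAt_nonpos ?_
    filter_upwards [h] with t ht hmem
    obtain ⟨u', h1, h2⟩ := ht hmem
    exact ⟨u', h1, h2.trans (by nlinarith [Real.sqrt_nonneg (u t)])⟩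
  have hmaps : ∀ t ∈ Set.Icc 0 T, u t ∈ Set.Icc (u T) (u 0) := fun t ht =>
    ⟨hanti ht (Set.right_mem_Icc.2 hT) ht.2, hanti (Set.left_mem_Icc.2 hT) ht ht.1⟩
  have hsqrt : ContDiffOn ℝ 1 Real.sqrt (Set.Icc (u T) (u 0)) := fun y hy =>
    (Real.contDiffAt_sqrt (hTpos.trans_le hy.1).ne').contDiffWithinAt
  obtain ⟨K, hK⟩ := hsqrt.exists_lipschitzOnWith (by decide) (convex_Icc _ _) isCompact_Icc
  have hAC : AbsolutelyContinuousOnInterval (fun t => √(u t)) 0 T := by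
    refine hu.lipschitzOnWith_comp (hK.mono ?_)
    rintro _ ⟨t, ht, rfl⟩
    exact hmaps t (by rwa [Set.uIcc_of_le hT] at ht)
  have key := hAC.sub_le_of_hasDerivAt_le hT (c := -c / 2) (by
    filter_upwards [h] with t ht hmem
    obtain ⟨u', h1, h2⟩ := ht hmem
    have hut : 0 < u t := hTpos.trans_le (hmaps t ⟨hmem.1.le, hmem.2.le⟩).1
    refine ⟨_, h1.sqrt hut.ne', ?_⟩
    rw [div_le_iff₀ (by positivity)]
    linarith)
  rw [div_le_iff₀ hc] at hT'
  have := Real.sqrt_pos.2 hTpos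
  nlinarith

/-- Integrating factor: `exp (α t) * u t` is antitone. -/
theorem le_exp_mul_of_hasDerivAt_le {u : ℝ → ℝ} {α T : ℝ} (hT : 0 ≤ T)
    (hu : AbsolutelyContinuousOnInterval u 0 T)
    (h : ∀ᵐ t : ℝ, t ∈ Set.Ioo 0 T → ∃ u', HasDerivAt u u' t ∧ u' ≤ -α * u t) :
    u T ≤ Real.exp (-α * T) * u 0 := by
  have hexp : AbsolutelyContinuousOnInterval (fun t : ℝ => Real.exp (α * t)) 0 T := by
    refine ContDiffOn.absolutelyContinuousOnInterval (ContDiff.contDiffOn ?_)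
    fun_prop
  have hanti := (hexp.mul hu).antitoneOn_of_hasDerivAt_nonpos (by
    filter_upwards [h] with t ht hmem
    obtain ⟨u', h1, h2⟩ := ht hmem
    refine ⟨_, (((hasDerivAt_id t).const_mul α).exp).mul h1, ?_⟩
    simp only [id]
    nlinarith [Real.exp_pos (α * t)])
  have := hanti (Set.left_mem_Icc.2 hT) (Set.right_mem_Icc.2 hT) hT
  simp only [Pi.mul_apply, mul_zero, Real.exp_zero, one_mul] at this
  rw [neg_mul, Real.exp_neg, inv_mul_eq_div, le_div_iff₀ (Real.exp_pos _)]
  linarith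

end AbsolutelyContinuousOnInterval

namespace HISO

/-! ### Hessians of admissible costs -/

namespace IsAdmissibleCost

variable {d : ℕ} {f : Vec d → ℝ}

theorem hasFDerivAt_gradient (hf : IsAdmissibleCost f) (x : Vec d) :
    HasFDerivAt (gradient f) (hessian f x) x :=
  (hf.differentiable_gradient x).hasFDerivAt

theorem inner_hessian_comm (hf : IsAdmissibleCost f) (x u w : Vec d) :
    inner ℝ (hessian f x u) w = inner ℝ (hessian f x w) u := by
  have h1 : ∀ y, HasFDerivAt f (InnerProductSpace.toDual ℝ (Vec d) (gradient f y)) y := fun y =>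
    (hf.differentiable y).hasGradientAt.hasFDerivAt
  have h2 := (InnerProductSpace.toDual ℝ (Vec d)).toContinuousLinearEquiv.toContinuousLinearMap
    |>.hasFDerivAt.comp x (hf.hasFDerivAt_gradient x)
  have := second_derivative_symmetric (f := f) h1 h2 u w
  simpa using this

/-- The two-sided Hessian bound in the form in which it is used: coercivity and cocoercivity. -/
theorem exists_bounds (hf : IsAdmissibleCost f) :
    ∃ m M : ℝ, 0 < m ∧ 0 < M ∧ ∀ x y : Vec d, m * ‖y‖ ≤ ‖hessian f x y‖ ∧
      ‖hessian f x y‖ ^ 2 ≤ M * inner ℝ y (hessian f x y) ∧ ‖hessian f x y‖ ≤ M * ‖y‖ := by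
  obtain ⟨m, M, hm, hM, h⟩ := hf.hessian_bounds
  refine ⟨m, M, hm, hM, fun x y => ?_⟩
  have hco : ‖hessian f x y‖ ^ 2 ≤ M * inner ℝ y (hessian f x y) := by
    set w := hessian f x y with hw
    -- Positivity of the Hessian form at `y - w/M`, expanded using symmetry and the upper bound at
    -- `w`, is exactly cocoercivity.
    have h1 := (h x (y - (1 / M) • w)).1
    have h2 := (h x w).2
    have h3 : inner ℝ y (hessian f x w) = inner ℝ w w := by
      rw [real_inner_comm, hf.inner_hessian_comm]
    have h4 : 0 ≤ m * ‖y - (1 / M) • w‖ ^ 2 := by positivity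
    rw [map_sub, map_smul, ← hw, inner_sub_left, inner_sub_right, inner_sub_right, inner_smul_left,
      inner_smul_left, inner_smul_right, inner_smul_right, h3, real_inner_self_eq_norm_sq] at h1
    simp only [conj_trivial] at h1
    have h5 : 0 ≤ inner ℝ y w - (1 / M) * ‖w‖ ^ 2
        - ((1 / M) * ‖w‖ ^ 2 - (1 / M) * ((1 / M) * (M * ‖w‖ ^ 2))) := by
      have : (1 / M) * ((1 / M) * inner ℝ w (hessian f x w))
          ≤ (1 / M) * ((1 / M) * (M * ‖w‖ ^ 2)) := by gcongr
      linarith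
    have h6 : inner ℝ y w - (1 / M) * ‖w‖ ^ 2
        - ((1 / M) * ‖w‖ ^ 2 - (1 / M) * ((1 / M) * (M * ‖w‖ ^ 2)))
        = (M * inner ℝ y w - ‖w‖ ^ 2) / M := by
      field_simp
      ring
    have h7 := mul_nonneg h5 hM.le
    rw [h6, div_mul_cancel₀ _ hM.ne'] at h7
    linarith
  have hcs := real_inner_le_norm y (hessian f x y)
  refine ⟨?_, hco, ?_⟩
  · have h1 := (h x y).1
    rcases (norm_nonneg y).eq_or_lt with h0 | h0
    · rw [← h0]; simp
    · nlinarith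
  · rcases (norm_nonneg (hessian f x y)).eq_or_lt with h0 | h0
    · rw [← h0]; positivity
    · nlinarith

theorem exists_lipschitzWith_gradient (hf : IsAdmissibleCost f) :
    ∃ K, LipschitzWith K (gradient f) := by
  obtain ⟨m, M, hm, hM, h⟩ := hf.exists_bounds
  refine ⟨⟨M, hM.le⟩, lipschitzWith_of_nnnorm_fderiv_le hf.differentiable_gradient fun x => ?_⟩
  exact ContinuousLinearMap.opNorm_le_bound _ hM.le fun y => (h x y).2.2

/-- Coercivity gives injectivity, which suffices in finite dimension. Hence `inverse` is a true
inverse rather than its default value `0`. -/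
theorem isInvertible_hessian (hf : IsAdmissibleCost f) (x : Vec d) :
    (hessian f x).IsInvertible := by
  obtain ⟨m, M, hm, hM, h⟩ := hf.exists_bounds
  have hinj : Function.Injective (hessian f x : Vec d →ₗ[ℝ] Vec d) := by
    rw [← LinearMap.ker_eq_bot, LinearMap.ker_eq_bot']
    intro y hy
    have h1 := (h x y).1
    rw [ContinuousLinearMap.coe_coe] at hy
    rw [hy, norm_zero] at h1
    exact norm_le_zero_iff.1 (by nlinarith [norm_nonneg y])
  refine ⟨(LinearEquiv.ofInjectiveEndo _ hinj).toContinuousLinearEquiv, ?_⟩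
  ext y
  simp

/-- Preconditioning by the inverse Hessian keeps the descent direction, up to the perturbation
`z`. -/
theorem exists_inner_inverse_hessian_lower_bound (hf : IsAdmissibleCost f) :
    ∃ κ K : ℝ, 0 < κ ∧ 0 ≤ K ∧ ∀ x z l : Vec d,
      κ * ‖l‖ ^ 2 - K * ‖z‖ ^ 2 ≤ inner ℝ ((hessian f x).inverse (z + l)) l := by
  obtain ⟨m, M, hm, hM, h⟩ := hf.exists_bounds
  -- Cocoercivity yields `‖z + l‖² / M`. One half absorbs the cross term `‖y‖ ‖z‖` by Young's
  -- inequality; the other half yields `‖l‖²` through `‖l‖² ≤ 2‖z + l‖² + 2‖z‖²`.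
  refine ⟨1 / (4 * M), 1 / (2 * M) + M / (2 * m ^ 2), by positivity, by positivity,
    fun x z l => ?_⟩
  set y := (hessian f x).inverse (z + l) with hy
  have hH : hessian f x y = z + l := (hf.isInvertible_hessian x).self_apply_inverse _
  obtain ⟨h1, h2, -⟩ := h x y
  rw [hH] at h1 h2
  have h3 : inner ℝ y l = inner ℝ y (z + l) - inner ℝ y z := by
    rw [inner_add_right]; ring
  have h4 := real_inner_le_norm y z
  have h5 : ‖l‖ ≤ ‖z + l‖ + ‖z‖ := by
    have := norm_sub_le (z + l) z
    rwa [add_sub_cancel_left] at this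
  have h5' : ‖l‖ ^ 2 ≤ 2 * ‖z + l‖ ^ 2 + 2 * ‖z‖ ^ 2 := by
    nlinarith [norm_nonneg l, sq_nonneg (‖z + l‖ - ‖z‖), norm_nonneg z, norm_nonneg (z + l)]
  have h6 : ‖y‖ ≤ ‖z + l‖ / m := by rw [le_div_iff₀ hm]; linarith
  have h7 : ‖z + l‖ ^ 2 / M ≤ inner ℝ y (z + l) := by rw [div_le_iff₀ hM]; linarith
  have h8 : ‖y‖ * ‖z‖ ≤ ‖z + l‖ ^ 2 / (2 * M) + M / (2 * m ^ 2) * ‖z‖ ^ 2 := by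
    have : ‖y‖ * ‖z‖ ≤ ‖z + l‖ / m * ‖z‖ := by gcongr
    refine this.trans ?_
    have e : ‖z + l‖ ^ 2 / (2 * M) + M / (2 * m ^ 2) * ‖z‖ ^ 2 - ‖z + l‖ / m * ‖z‖
        = (‖z + l‖ - M / m * ‖z‖) ^ 2 / (2 * M) := by
      field_simp
      ring
    have : 0 ≤ (‖z + l‖ - M / m * ‖z‖) ^ 2 / (2 * M) := by positivity
    linarith
  have h9 : 1 / (4 * M) * ‖l‖ ^ 2 ≤ ‖z + l‖ ^ 2 / (2 * M) + 1 / (2 * M) * ‖z‖ ^ 2 := by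
    calc 1 / (4 * M) * ‖l‖ ^ 2 ≤ 1 / (4 * M) * (2 * ‖z + l‖ ^ 2 + 2 * ‖z‖ ^ 2) := by gcongr
      _ = _ := by field_simp; ring
  have h10 : ‖z + l‖ ^ 2 / M = ‖z + l‖ ^ 2 / (2 * M) + ‖z + l‖ ^ 2 / (2 * M) := by
    field_simp; ring
  linarith

end IsAdmissibleCost

end HISO

namespace HISO

variable {N d : ℕ}

/-! ### Filippov regularization -/

theorem filippovMap_subset_of_eventually {E F : Type*} [PseudoMetricSpace E] [MeasureSpace E]
    [NormedAddCommGroup F] [NormedSpace ℝ F] {Φ : E → F} {y : E} {C : Set F}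
    (hconv : Convex ℝ C) (hclosed : IsClosed C) (h : ∀ᶠ y' in 𝓝 y, Φ y' ∈ C) :
    filippovMap Φ y ⊆ C := by
  intro s hs
  obtain ⟨δ, hδ, hball⟩ := Metric.eventually_nhds_iff_ball.1 h
  simp only [filippovMap, Set.mem_iInter] at hs
  refine closure_minimal (convexHull_min ?_ hconv) hclosed (hs δ hδ ∅ measure_empty)
  rintro _ ⟨y', hy', rfl⟩
  exact hball y' hy'.1

/-- A level set of a continuous linear map is closed and convex, so an identity holding near `y`
survives the regularization. -/
theorem eq_of_mem_filippovMap {E F : Type*} [PseudoMetricSpace E] [MeasureSpace E]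
    [NormedAddCommGroup F] [NormedSpace ℝ F] {H : Type*} [NormedAddCommGroup H] [NormedSpace ℝ H]
    {Φ : E → F} {y : E} {s : F} (hs : s ∈ filippovMap Φ y) (A : F →L[ℝ] H) {c : H}
    (h : ∀ᶠ y' in 𝓝 y, A (Φ y') = c) : A s = c :=
  filippovMap_subset_of_eventually (C := A ⁻¹' {c})
    ((convex_singleton c).linear_preimage A.toLinearMap)
    (isClosed_singleton.preimage A.continuous) h hs

/-! ### Couplings along the edges of a graph -/

/-- Triangle inequality along a path, which has fewer than `N` edges. -/
theorem norm_sub_le_of_adj_le {G : SimpleGraph (Fin N)} {E : Type*} [SeminormedAddCommGroup E] (hG : G.Connected)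
    {x : Fin N → E} {r : ℝ} (hr : 0 ≤ r) (h : ∀ i j, G.Adj i j → ‖x i - x j‖ ≤ r) (i j : Fin N) :
    ‖x i - x j‖ ≤ N * r := by
  have hwalk : ∀ {i j : Fin N} (p : G.Walk i j), ‖x i - x j‖ ≤ p.length * r := by
    intro i j p
    induction p with
    | nil => simp
    | cons hadj p ih =>
      rename_i u v w
      have h1 := h _ _ hadj
      have h2 := norm_sub_le_norm_sub_add_norm_sub (x u) (x v) (x w)
      push_cast [SimpleGraph.Walk.length_cons]
      linarith
  obtain ⟨p, hp⟩ := (hG i j).exists_isPath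
  refine (hwalk p).trans ?_
  have : p.length < N := by simpa using hp.length_lt
  gcongr

section Coupling

variable (G : SimpleGraph (Fin N)) [DecidableRel G.Adj]

theorem adjMatrix_comm (i j : Fin N) : G.adjMatrix ℝ i j = G.adjMatrix ℝ j i := by
  simp [SimpleGraph.adjMatrix_apply, G.adj_comm]

theorem adjMatrix_nonneg (i j : Fin N) : 0 ≤ G.adjMatrix ℝ i j := by
  rw [SimpleGraph.adjMatrix_apply]
  split_ifs <;> norm_num

theorem sum_odd_coupling {φ : Vec d → Vec d} (hφ : ∀ u, φ (-u) = -φ u) (z : Net N d) :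
    ∑ i, ∑ j, G.adjMatrix ℝ i j • φ (z i - z j) = 0 := by
  have h : ∑ i, ∑ j, G.adjMatrix ℝ i j • φ (z i - z j)
      = -∑ i, ∑ j, G.adjMatrix ℝ i j • φ (z i - z j) := by
    conv_lhs => rw [Finset.sum_comm]
    rw [← Finset.sum_neg_distrib]
    refine Finset.sum_congr rfl fun i _ => ?_
    rw [← Finset.sum_neg_distrib]
    refine Finset.sum_congr rfl fun j _ => ?_
    rw [← smul_neg, ← hφ, neg_sub, adjMatrix_comm]
  have h2 : (2 : ℝ) • ∑ i, ∑ j, G.adjMatrix ℝ i j • φ (z i - z j) = 0 := by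
    rw [two_smul]
    exact eq_neg_iff_add_eq_zero.1 h
  exact (smul_eq_zero.1 h2).resolve_left two_ne_zero

/-- Summation by parts: swap `i` and `j` and use oddness. Keeping `w` separate from `z` allows
pairing a fixed vector with the coupling at nearby points. -/
theorem sum_inner_odd_coupling {φ : Vec d → Vec d} (hφ : ∀ u, φ (-u) = -φ u) (w z : Net N d) :
    ∑ i, inner ℝ (w i) (∑ j, G.adjMatrix ℝ i j • φ (z i - z j)) =
      1 / 2 * ∑ i, ∑ j, G.adjMatrix ℝ i j * inner ℝ (w i - w j) (φ (z i - z j)) := by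
  have h1 : ∑ i, inner ℝ (w i) (∑ j, G.adjMatrix ℝ i j • φ (z i - z j))
      = ∑ i, ∑ j, G.adjMatrix ℝ i j * inner ℝ (w i) (φ (z i - z j)) := by
    simp only [inner_sum, inner_smul_right]
  have h2 : ∑ i, ∑ j, G.adjMatrix ℝ i j * inner ℝ (w i) (φ (z i - z j))
      = -∑ i, ∑ j, G.adjMatrix ℝ i j * inner ℝ (w j) (φ (z i - z j)) := by
    conv_lhs => rw [Finset.sum_comm]
    rw [← Finset.sum_neg_distrib]
    refine Finset.sum_congr rfl fun i _ => ?_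
    rw [← Finset.sum_neg_distrib]
    refine Finset.sum_congr rfl fun j _ => ?_
    rw [← mul_neg, ← inner_neg_right, ← hφ, neg_sub, adjMatrix_comm]
  rw [h1]
  simp only [inner_sub_left, mul_sub, Finset.sum_sub_distrib]
  linarith

theorem sgn_neg (u : Vec d) : sgn (-u) = -sgn u := by
  ext k
  simp [sgn, Real.sign_neg]

theorem sum_signCoupling (z : Net N d) : ∑ i, signCoupling G z i = 0 :=
  sum_odd_coupling G sgn_neg z

theorem sum_linearCoupling (x : Net N d) : ∑ i, linearCoupling G x i = 0 :=
  sum_odd_coupling G (φ := id) (fun _ => rfl) x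

/-- The total variation `½ ∑ a_ij ‖z^i - z^j‖₁` of `z` over the edges of the graph. -/
noncomputable def edgeVariation (z : Net N d) : ℝ :=
  1 / 2 * ∑ i, ∑ j, G.adjMatrix ℝ i j * inner ℝ (z i - z j) (sgn (z i - z j))

/-- The Dirichlet energy `½ ∑ a_ij ‖x^i - x^j‖²` of `x`. -/
noncomputable def edgeEnergy (x : Net N d) : ℝ :=
  1 / 2 * ∑ i, ∑ j, G.adjMatrix ℝ i j * ‖x i - x j‖ ^ 2

theorem inner_eq_sum_mul (u w : Vec d) : inner ℝ u w = ∑ k, u k * w k := by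
  simp [PiLp.inner_apply, mul_comm]

theorem norm_le_inner_sgn (u : Vec d) : ‖u‖ ≤ inner ℝ u (sgn u) := by
  have h : inner ℝ u (sgn u) = ∑ k, |u k| := by
    rw [inner_eq_sum_mul]
    refine Finset.sum_congr rfl fun k _ => ?_
    rcases lt_trichotomy (u k) 0 with h | h | h
    · simp [sgn, Real.sign_of_neg h, abs_of_neg h]
    · simp [sgn, h]
    · simp [sgn, Real.sign_of_pos h, abs_of_pos h]
  rw [h, EuclideanSpace.norm_eq]
  refine Real.sqrt_le_iff.2 ⟨Finset.sum_nonneg fun _ _ => abs_nonneg _, ?_⟩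
  simpa using Finset.sum_sq_le_sq_sum_of_nonneg (s := Finset.univ) (f := fun k => |u k|)
    fun k _ => abs_nonneg _

theorem edgeVariation_nonneg (z : Net N d) : 0 ≤ edgeVariation G z :=
  mul_nonneg (by norm_num) <| Finset.sum_nonneg fun i _ => Finset.sum_nonneg fun j _ =>
    mul_nonneg (adjMatrix_nonneg G i j) ((norm_nonneg _).trans (norm_le_inner_sgn _))

theorem edgeEnergy_nonneg (x : Net N d) : 0 ≤ edgeEnergy G x :=
  mul_nonneg (by norm_num) <| Finset.sum_nonneg fun i _ => Finset.sum_nonneg fun j _ =>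
    mul_nonneg (adjMatrix_nonneg G i j) (by positivity)

variable {G}

theorem le_sum_of_adj {c : Fin N → Fin N → ℝ} (hc : ∀ i j, 0 ≤ c i j) {i j : Fin N}
    (hij : G.Adj i j) : c i j ≤ ∑ i, ∑ j, G.adjMatrix ℝ i j * c i j := by
  have h0 : ∀ i j, 0 ≤ G.adjMatrix ℝ i j * c i j := fun i j =>
    mul_nonneg (adjMatrix_nonneg G i j) (hc i j)
  calc c i j = G.adjMatrix ℝ i j * c i j := by simp [SimpleGraph.adjMatrix_apply, hij]
    _ ≤ ∑ j, G.adjMatrix ℝ i j * c i j :=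
      Finset.single_le_sum (f := fun j => G.adjMatrix ℝ i j * c i j) (fun j _ => h0 i j)
        (Finset.mem_univ j)
    _ ≤ _ :=
      Finset.single_le_sum (f := fun i => ∑ j, G.adjMatrix ℝ i j * c i j)
        (fun i _ => Finset.sum_nonneg fun j _ => h0 i j) (Finset.mem_univ i)

theorem norm_sub_le_edgeVariation {i j : Fin N} (hij : G.Adj i j) (z : Net N d) :
    ‖z i - z j‖ ≤ 2 * edgeVariation G z := by
  have h := le_sum_of_adj (c := fun i j => inner ℝ (z i - z j) (sgn (z i - z j)))
    (fun i j => (norm_nonneg _).trans (norm_le_inner_sgn _)) hij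
  have := norm_le_inner_sgn (z i - z j)
  simp only [edgeVariation]
  linarith

theorem norm_sub_sq_le_edgeEnergy {i j : Fin N} (hij : G.Adj i j) (x : Net N d) :
    ‖x i - x j‖ ^ 2 ≤ 2 * edgeEnergy G x := by
  have h := le_sum_of_adj (c := fun i j => ‖x i - x j‖ ^ 2) (fun i j => by positivity) hij
  simp only [edgeEnergy]
  linarith

theorem norm_sub_le_sqrt_edgeEnergy (hG : G.Connected) (x : Net N d) (i j : Fin N) :
    ‖x i - x j‖ ≤ N * √(2 * edgeEnergy G x) :=
  norm_sub_le_of_adj_le hG (Real.sqrt_nonneg _)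
    (fun _ _ hij => Real.le_sqrt_of_sq_le (norm_sub_sq_le_edgeEnergy hij x)) i j

theorem sum_inner_linearCoupling (w x : Net N d) :
    ∑ i, inner ℝ (w i) (linearCoupling G x i) =
      1 / 2 * ∑ i, ∑ j, G.adjMatrix ℝ i j * inner ℝ (w i - w j) (x i - x j) :=
  sum_inner_odd_coupling G (φ := id) (fun _ => rfl) w x

theorem sum_inner_self_linearCoupling (x : Net N d) :
    ∑ i, inner ℝ (x i) (linearCoupling G x i) = edgeEnergy G x := by
  rw [sum_inner_linearCoupling, edgeEnergy]
  simp only [real_inner_self_eq_norm_sq]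

/-- A Poincaré inequality: the Dirichlet energy is controlled by the norm of the Laplacian. -/
theorem edgeEnergy_le (hG : G.Connected) (x : Net N d) :
    edgeEnergy G x ≤ 2 * N ^ 3 * ∑ i, ‖linearCoupling G x i‖ ^ 2 := by
  obtain ⟨o⟩ := hG.nonempty
  set W := edgeEnergy G x with hW
  have hW0 : 0 ≤ W := edgeEnergy_nonneg G x
  set l := linearCoupling G x with hl
  -- The blocks of `l` sum to zero, so `x` may be recentred at `x o`.
  have h1 : W = ∑ i, inner ℝ (x i - x o) (l i) := by
    simp only [inner_sub_left, Finset.sum_sub_distrib]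
    rw [← inner_sum, hl, sum_linearCoupling, inner_zero_right, sub_zero,
      sum_inner_self_linearCoupling]
  have h2 : W ≤ (N * √(2 * W)) * ∑ i, ‖l i‖ := by
    rw [Finset.mul_sum]
    conv_lhs => rw [h1]
    refine Finset.sum_le_sum fun i _ => (real_inner_le_norm _ _).trans ?_
    gcongr
    exact norm_sub_le_sqrt_edgeEnergy hG x i o
  have h3 : (∑ i, ‖l i‖) ^ 2 ≤ N * ∑ i, ‖l i‖ ^ 2 := by
    simpa using sq_sum_le_card_mul_sum_sq (s := Finset.univ) (f := fun i => ‖l i‖)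
  have h4 : W ^ 2 ≤ (2 * N ^ 3 * ∑ i, ‖l i‖ ^ 2) * W := by
    calc W ^ 2 ≤ ((N * √(2 * W)) * ∑ i, ‖l i‖) ^ 2 := by gcongr
      _ = N ^ 2 * (2 * W) * (∑ i, ‖l i‖) ^ 2 := by
        rw [mul_pow, mul_pow, Real.sq_sqrt (by positivity)]
      _ ≤ N ^ 2 * (2 * W) * (N * ∑ i, ‖l i‖ ^ 2) := by gcongr
      _ = _ := by ring
  rcases hW0.eq_or_lt with h0 | h0
  · rw [← h0]; positivity
  · nlinarith

/-! ### The Filippov regularization of the sign coupling -/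

/-- Where `u k ≠ 0` the sign is locally constant; where `u k = 0` the factor `u k` hides the jump.
-/
theorem eventually_inner_sgn_eq (u : Vec d) :
    ∀ᶠ u' in 𝓝 u, inner ℝ u (sgn u') = inner ℝ u (sgn u) := by
  have h : ∀ k, ∀ᶠ u' : Vec d in 𝓝 u, u k * sgn u' k = u k * sgn u k := by
    intro k
    have hc : ContinuousAt (fun u' : Vec d => u' k) u := by fun_prop
    rcases lt_trichotomy (u k) 0 with h | h | h
    · filter_upwards [hc.eventually_lt_const h] with u' hu'
      simp [sgn, Real.sign_of_neg h, Real.sign_of_neg hu']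
    · simp [h]
    · filter_upwards [hc.eventually_const_lt h] with u' hu'
      simp [sgn, Real.sign_of_pos h, Real.sign_of_pos hu']
  filter_upwards [eventually_all.2 h] with u' hu'
  simp only [inner_eq_sum_mul]
  exact Finset.sum_congr rfl fun k _ => hu' k

theorem sum_of_mem_filippovMap {z s : Net N d} (hs : s ∈ filippovMap (signCoupling G) z) :
    ∑ i, s i = 0 := by
  have := eq_of_mem_filippovMap hs
    (∑ i, ContinuousLinearMap.proj (R := ℝ) (φ := fun _ : Fin N => Vec d) i) (c := 0)
    (Eventually.of_forall fun z' => by simpa using sum_signCoupling G z')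
  simpa using this

theorem sum_inner_of_mem_filippovMap {z s : Net N d}
    (hs : s ∈ filippovMap (signCoupling G) z) :
    ∑ i, inner ℝ (z i) (s i) = edgeVariation G z := by
  have hev : ∀ᶠ z' : Net N d in 𝓝 z, ∀ i j,
      inner ℝ (z i - z j) (sgn (z' i - z' j)) = inner ℝ (z i - z j) (sgn (z i - z j)) := by
    refine eventually_all.2 fun i => eventually_all.2 fun j => ?_
    have hc : ContinuousAt (fun z' : Net N d => z' i - z' j) z := by fun_prop
    exact hc.eventually (eventually_inner_sgn_eq (z i - z j))
  have := eq_of_mem_filippovMap hs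
    (∑ i, (innerSL ℝ (z i)).comp
      (ContinuousLinearMap.proj (R := ℝ) (φ := fun _ : Fin N => Vec d) i))
    (c := edgeVariation G z) (by
      filter_upwards [hev] with z' hz'
      have h := sum_inner_odd_coupling G sgn_neg z z'
      simp only [hz'] at h
      simp only [_root_.sum_apply, ContinuousLinearMap.comp_apply,
        ContinuousLinearMap.proj_apply, innerSL_apply_apply]
      exact h)
  simpa using this

end Coupling

end HISO

/-! ### Lyapunov functions and their derivatives -/

namespace HISO

variable {N d : ℕ} {G : SimpleGraph (Fin N)} [DecidableRel G.Adj] {f : Fin N → Vec d → ℝ}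
  {x v : ℝ → Net N d}

/-- The disagreement `∑ ‖z^i - z^j‖²` of the outputs. -/
noncomputable def disagreement (z : Net N d) : ℝ := ∑ i, ∑ j, ‖z i - z j‖ ^ 2

theorem contDiff_disagreement : ContDiff ℝ 1 (disagreement (N := N) (d := d)) := by
  unfold disagreement
  refine ContDiff.sum fun i _ => ContDiff.sum fun j _ => ContDiff.norm_sq ℝ ?_
  fun_prop

theorem contDiff_edgeEnergy : ContDiff ℝ 1 (edgeEnergy (d := d) G) := by
  unfold edgeEnergy
  refine contDiff_const.mul (ContDiff.sum fun i _ => ContDiff.sum fun j _ =>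
    contDiff_const.mul (ContDiff.norm_sq ℝ ?_))
  fun_prop

theorem contDiff_sum_norm_sq : ContDiff ℝ 1 (fun z : Net N d => ∑ i, ‖z i‖ ^ 2) := by
  refine ContDiff.sum fun i _ => ContDiff.norm_sq ℝ ?_
  fun_prop

theorem disagreement_nonneg (z : Net N d) : 0 ≤ disagreement z :=
  Finset.sum_nonneg fun _ _ => Finset.sum_nonneg fun _ _ => by positivity

theorem eq_of_disagreement_eq_zero {z : Net N d} (h : disagreement z = 0) (i j : Fin N) :
    z i = z j := by
  have h1 := (Finset.sum_eq_zero_iff_of_nonneg fun i _ =>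
    Finset.sum_nonneg fun j _ => sq_nonneg ‖z i - z j‖).1 h i (Finset.mem_univ i)
  have h2 := (Finset.sum_eq_zero_iff_of_nonneg fun j _ => sq_nonneg ‖z i - z j‖).1 h1 j
    (Finset.mem_univ j)
  exact sub_eq_zero.1 (norm_eq_zero.1 (pow_eq_zero_iff two_ne_zero |>.1 h2))

theorem sqrt_disagreement_le (hG : G.Connected) (z : Net N d) :
    √(disagreement z) ≤ 2 * N ^ 2 * edgeVariation G z := by
  have hV := edgeVariation_nonneg G z
  refine Real.sqrt_le_iff.2 ⟨by positivity, ?_⟩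
  have h : ∀ i j, ‖z i - z j‖ ^ 2 ≤ (N * (2 * edgeVariation G z)) ^ 2 := fun i j => by
    have := norm_sub_le_of_adj_le hG (by positivity)
      (fun i j hij => norm_sub_le_edgeVariation hij z) i j
    gcongr
  calc disagreement z ≤ ∑ _i : Fin N, ∑ _j : Fin N, (N * (2 * edgeVariation G z)) ^ 2 :=
        Finset.sum_le_sum fun i _ => Finset.sum_le_sum fun j _ => h i j
    _ = _ := by
      simp only [Finset.sum_const, Finset.card_univ, Fintype.card_fin, nsmul_eq_mul]
      ring

section Derivatives

variable {z : ℝ → Net N d} {z' : Net N d} {t : ℝ}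

theorem hasDerivAt_sum_norm_sq (hz : HasDerivAt z z' t) :
    HasDerivAt (fun t => ∑ i, ‖z t i‖ ^ 2) (∑ i, 2 * inner ℝ (z t i) (z' i)) t :=
  HasDerivAt.fun_sum fun i _ => (hasDerivAt_pi.1 hz i).norm_sq

theorem hasDerivAt_disagreement (hz : HasDerivAt z z' t) :
    HasDerivAt (fun t => disagreement (z t))
      (∑ i, ∑ j, 2 * inner ℝ (z t i - z t j) (z' i - z' j)) t :=
  HasDerivAt.fun_sum fun i _ => HasDerivAt.fun_sum fun j _ =>
    ((hasDerivAt_pi.1 hz i).sub (hasDerivAt_pi.1 hz j)).norm_sq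

theorem hasDerivAt_edgeEnergy (hz : HasDerivAt z z' t) :
    HasDerivAt (fun t => edgeEnergy G (z t)) (2 * ∑ i, inner ℝ (z' i) (linearCoupling G (z t) i))
      t := by
  have h : HasDerivAt (fun t => edgeEnergy G (z t)) (1 / 2 * ∑ i, ∑ j, G.adjMatrix ℝ i j *
      (2 * inner ℝ (z t i - z t j) (z' i - z' j))) t :=
    HasDerivAt.const_mul _ <| HasDerivAt.fun_sum fun i _ => HasDerivAt.fun_sum fun j _ =>
      HasDerivAt.const_mul _ ((hasDerivAt_pi.1 hz i).sub (hasDerivAt_pi.1 hz j)).norm_sq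
  convert h using 1
  rw [sum_inner_linearCoupling]
  simp only [Finset.mul_sum]
  refine Finset.sum_congr rfl fun i _ => Finset.sum_congr rfl fun j _ => ?_
  rw [real_inner_comm]
  ring

end Derivatives

theorem sum_sum_inner_sub_sub (u w : Net N d) (hw : ∑ i, w i = 0) :
    ∑ i, ∑ j, inner ℝ (u i - u j) (w i - w j) = 2 * N * ∑ i, inner ℝ (u i) (w i) := by
  have h1 : ∑ i, ∑ j, inner ℝ (u i) (w j) = 0 := by simp [← inner_sum, hw]
  have h2 : ∑ i, ∑ j, inner ℝ (u j) (w i) = 0 := by rw [Finset.sum_comm]; exact h1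
  simp only [inner_sub_left, inner_sub_right, Finset.sum_sub_distrib, h1, h2, Finset.sum_const,
    Finset.card_univ, Fintype.card_fin, nsmul_eq_mul, ← Finset.mul_sum]
  ring

/-! ### Behaviour of solutions -/

namespace IsSolution

theorem absolutelyContinuous_output (hf : ∀ i, IsAdmissibleCost (f i)) (h : IsSolution G f x v)
    {T : ℝ} (hT : 0 ≤ T) :
    AbsolutelyContinuousOnInterval (fun t => output f (x t) (v t)) 0 T := by
  choose K hK using fun i => (hf i).exists_lipschitzWith_gradient
  have hlip : LipschitzWith (∑ i, K i) (fun (y : Net N d) i => gradient (f i) (y i)) := by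
    refine LipschitzWith.of_dist_le_mul fun y y' => (dist_pi_le_iff (by positivity)).2 fun i => ?_
    refine ((hK i).dist_le_mul _ _).trans ?_
    gcongr
    · exact Finset.single_le_sum (f := K) (fun _ _ => zero_le) (Finset.mem_univ i)
    · exact dist_le_pi_dist y y' i
  exact ((h.absolutelyContinuous_x T hT).lipschitzOnWith_comp hlip.lipschitzOnWith).add
    (h.absolutelyContinuous_v T hT)

/-- The closed-loop equation `ż = -z - s` of the outputs. -/
theorem ae_hasDerivAt_output (hf : ∀ i, IsAdmissibleCost (f i)) (h : IsSolution G f x v) :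
    ∀ᵐ t : ℝ, 0 < t → ∃ s ∈ filippovMap (signCoupling (d := d) G) (output f (x t) (v t)),
      HasDerivAt (fun t => output f (x t) (v t)) (fun i => -output f (x t) (v t) i - s i) t := by
  filter_upwards [h.ode_x, h.ode_v] with t hx hv ht
  obtain ⟨s, hs, hv⟩ := hv ht
  refine ⟨s, hs, hasDerivAt_pi.2 fun i => ?_⟩
  have h1 := ((hf i).hasFDerivAt_gradient (x t i)).comp_hasDerivAt t (hasDerivAt_pi.1 (hx ht) i)
  have h2 := h1.add (hasDerivAt_pi.1 hv i)
  refine HasDerivAt.congr_deriv (f := fun t => output f (x t) (v t) i) h2 ?_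
  -- After `H H⁻¹` cancels, so do the two linear couplings.
  rw [map_neg, ((hf i).isInvertible_hessian (x t i)).self_apply_inverse]
  abel

theorem sum_v_eq_zero (h : IsSolution G f x v) (hv₀ : ∑ i, v 0 i = 0) {t : ℝ} (ht : 0 ≤ t) :
    ∑ i, v t i = 0 := by
  have hAC : AbsolutelyContinuousOnInterval (fun t => ∑ i, v t i) 0 t :=
    (h.absolutelyContinuous_v t ht).contDiff_comp (φ := fun w : Net N d => ∑ i, w i)
      (by fun_prop)
  obtain ⟨C, hC⟩ := hAC.const_of_ae_hasDerivAt_zero (by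
    -- The constancy criterion concerns the closed interval, while the equation is only available
    -- for positive times.
    filter_upwards [h.ode_v, Measure.ae_ne volume (0 : ℝ)] with r hr hr0 hmem
    rw [Set.uIcc_of_le ht] at hmem
    obtain ⟨s, hs, hv⟩ := hr (lt_of_le_of_ne hmem.1 hr0.symm)
    have := HasDerivAt.fun_sum (u := Finset.univ) fun i _ => hasDerivAt_pi.1 hv i
    convert this using 1
    rw [Finset.sum_add_distrib, Finset.sum_neg_distrib, sum_of_mem_filippovMap hs,
      sum_linearCoupling, neg_zero, add_zero])
  rw [hC t Set.right_mem_uIcc, ← hC 0 Set.left_mem_uIcc, hv₀]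

theorem disagreement_output_eq_zero (hG : G.Connected) (hf : ∀ i, IsAdmissibleCost (f i))
    (h : IsSolution G f x v) {t : ℝ} (ht : N * √(disagreement (output f (x 0) (v 0))) ≤ t) :
    disagreement (output f (x t) (v t)) = 0 := by
  obtain ⟨o⟩ := hG.nonempty
  have hN : (0 : ℝ) < N := by exact_mod_cast o.pos
  have ht0 : 0 ≤ t := le_trans (by positivity) ht
  refine AbsolutelyContinuousOnInterval.eq_zero_of_hasDerivAt_le_neg_sqrt
    -- The decay `4 N V`, with `V` the edge variation, and `√D ≤ 2 N² V` give `c = 2/N`, so the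
    -- extinction time `2 √D(0) / c` is `N √D(0)`.
    (u := fun t => disagreement (output f (x t) (v t))) (c := 2 / N) (by positivity) ht0
    ((h.absolutelyContinuous_output hf ht0).contDiff_comp contDiff_disagreement)
    (fun _ => disagreement_nonneg _) ?_ (by convert ht using 1; field_simp)
  filter_upwards [h.ae_hasDerivAt_output hf] with r hr hmem
  obtain ⟨s, hs, hz⟩ := hr hmem.1
  refine ⟨_, hasDerivAt_disagreement hz, ?_⟩
  set z := output f (x r) (v r)
  have h1 : ∑ i, ∑ j, 2 * inner ℝ (z i - z j) ((-z i - s i) - (-z j - s j))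
      = -2 * disagreement z - 4 * N * edgeVariation G z := by
    have : ∀ i j, 2 * inner ℝ (z i - z j) ((-z i - s i) - (-z j - s j))
        = -2 * ‖z i - z j‖ ^ 2 - 2 * inner ℝ (z i - z j) (s i - s j) := fun i j => by
      rw [show (-z i - s i) - (-z j - s j) = -(z i - z j) - (s i - s j) by abel, inner_sub_right,
        inner_neg_right, real_inner_self_eq_norm_sq]
      ring
    simp only [this, Finset.sum_sub_distrib, ← Finset.mul_sum]
    rw [sum_sum_inner_sub_sub z s (sum_of_mem_filippovMap hs), sum_inner_of_mem_filippovMap hs,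
      disagreement]
    ring
  rw [h1]
  have h2 := sqrt_disagreement_le hG z
  have h3 := disagreement_nonneg z
  have h4 : 2 / N * √(disagreement z) ≤ 4 * N * edgeVariation G z := by
    calc 2 / N * √(disagreement z) ≤ 2 / N * (2 * N ^ 2 * edgeVariation G z) := by gcongr
      _ = _ := by field_simp; ring
  linarith

/-- The edge energy of the decisions decays exponentially. -/
theorem exists_edgeEnergy_le_exp (hG : G.Connected) (hf : ∀ i, IsAdmissibleCost (f i))
    (h : IsSolution G f x v) :
    ∃ α C : ℝ, 0 < α ∧ ∀ t, 0 ≤ t → edgeEnergy G (x t) ≤ Real.exp (-α * t) * C := by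
  have := hG.nonempty
  have hN : (0 : ℝ) < N := by exact_mod_cast (Classical.arbitrary (Fin N)).pos
  choose κ' K' hκ' hK' hbound' using fun i => (hf i).exists_inner_inverse_hessian_lower_bound
  obtain ⟨iκ, hiκ⟩ := Finite.exists_min κ'
  obtain ⟨iK, hiK⟩ := Finite.exists_max K'
  set κ := κ' iκ
  set K := K' iK
  have hκ : 0 < κ := hκ' _
  have hK : 0 ≤ K := hK' _
  have hbound : ∀ i (y z l : Vec d), κ * ‖l‖ ^ 2 - K * ‖z‖ ^ 2 ≤
      inner ℝ ((hessian (f i) y).inverse (z + l)) l := fun i y z l => by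
    refine le_trans ?_ (hbound' i y z l)
    have h1 := hiκ i
    have h2 := hiK i
    gcongr
  -- The energy has derivative at most `-2κ ∑ ‖l i‖² + 2K Z`. Adding `2K Z`, whose derivative is at
  -- most `-4K Z`, leaves `-2K Z`: rate `1` for that part. The Poincaré constant `2 N³` gives rate
  -- `κ / N³` for the energy.
  set α := min (κ / N ^ 3) 1
  set Z : ℝ → ℝ := fun t => ∑ i, ‖output f (x t) (v t) i‖ ^ 2
  refine ⟨α, edgeEnergy G (x 0) + 2 * K * Z 0, by positivity, fun T hT => ?_⟩
  have hZ0 : ∀ t, 0 ≤ Z t := fun t => by positivity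
  have key := AbsolutelyContinuousOnInterval.le_exp_mul_of_hasDerivAt_le (α := α)
    (u := fun t => edgeEnergy G (x t) + 2 * K * Z t) hT
    (((h.absolutelyContinuous_x T hT).contDiff_comp contDiff_edgeEnergy).add
      (((h.absolutelyContinuous_output hf hT).contDiff_comp contDiff_sum_norm_sq).const_mul
        (2 * K))) (by
    filter_upwards [h.ode_x, h.ae_hasDerivAt_output hf] with t hx hz hmem
    obtain ⟨s, hs, hz⟩ := hz hmem.1
    refine ⟨_, (hasDerivAt_edgeEnergy (hx hmem.1)).add
      ((hasDerivAt_sum_norm_sq hz).const_mul (2 * K)), ?_⟩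
    have hZt := hZ0 t
    simp only [Z] at hZt ⊢
    set z := output f (x t) (v t)
    set l := linearCoupling G (x t)
    have h1 : ∑ i, inner ℝ (-((hessian (f i) (x t i)).inverse (z i + l i))) (l i)
        ≤ -(κ * ∑ i, ‖l i‖ ^ 2) + K * ∑ i, ‖z i‖ ^ 2 := by
      rw [Finset.mul_sum, Finset.mul_sum, ← Finset.sum_neg_distrib, ← Finset.sum_add_distrib]
      refine Finset.sum_le_sum fun i _ => ?_
      rw [inner_neg_left]
      linarith [hbound i (x t i) (z i) (l i)]
    have h2 : ∑ i, 2 * inner ℝ (z i) (-z i - s i)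
        = -2 * ∑ i, ‖z i‖ ^ 2 - 2 * edgeVariation G z := by
      rw [← sum_inner_of_mem_filippovMap hs, ← Finset.mul_sum]
      simp only [inner_sub_right, inner_neg_right, real_inner_self_eq_norm_sq,
        Finset.sum_sub_distrib, Finset.sum_neg_distrib]
      ring
    have h3 : α * edgeEnergy G (x t) ≤ 2 * (κ * ∑ i, ‖l i‖ ^ 2) := by
      have hW := edgeEnergy_nonneg G (x t)
      calc α * edgeEnergy G (x t) ≤ κ / N ^ 3 * (2 * N ^ 3 * ∑ i, ‖l i‖ ^ 2) :=
            mul_le_mul (min_le_left _ _) (edgeEnergy_le hG (x t)) hW (by positivity)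
        _ = _ := by field_simp
    have h4 : α * (2 * K * ∑ i, ‖z i‖ ^ 2) ≤ 1 * (2 * K * ∑ i, ‖z i‖ ^ 2) := by
      gcongr
      exact min_le_right _ _
    have h5 : 0 ≤ 2 * K * (2 * edgeVariation G z) := by
      have := edgeVariation_nonneg G z
      positivity
    rw [h2]
    nlinarith)
  have : 0 ≤ 2 * K * Z T := by have := hZ0 T; positivity
  linarith

theorem tendsto_sub (hG : G.Connected) (hf : ∀ i, IsAdmissibleCost (f i))
    (h : IsSolution G f x v) (i j : Fin N) :
    Tendsto (fun t => x t i - x t j) atTop (𝓝 0) := by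
  obtain ⟨α, C, hα, hC⟩ := h.exists_edgeEnergy_le_exp hG hf
  have hexp : Tendsto (fun t : ℝ => Real.exp (-α * t) * C) atTop (𝓝 0) := by
    have : Tendsto (fun t : ℝ => -α * t) atTop atBot :=
      tendsto_id.const_mul_atTop_of_neg (neg_lt_zero.2 hα)
    simpa using (Real.tendsto_exp_atBot.comp this).mul_const C
  have hW : Tendsto (fun t => edgeEnergy G (x t)) atTop (𝓝 0) :=
    squeeze_zero' (Eventually.of_forall fun t => edgeEnergy_nonneg G (x t))
      (eventually_atTop.2 ⟨0, hC⟩) hexp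
  refine squeeze_zero_norm (fun t => norm_sub_le_sqrt_edgeEnergy hG (x t) i j) ?_
  simpa using ((hW.const_mul 2).sqrt).const_mul (N : ℝ)

end IsSolution

end HISO

theorem lemma2 {N d : ℕ} (G : SimpleGraph (Fin N)) [DecidableRel G.Adj] (hG : G.Connected)
    (f : Fin N → HISO.Vec d → ℝ) (hf : ∀ i, HISO.IsAdmissibleCost (f i))
    (x₀ v₀ : HISO.Net N d) (hv₀ : ∑ i, v₀ i = 0) :
    ∃ T : ℝ, 0 ≤ T ∧ ∀ x v : ℝ → HISO.Net N d,
      HISO.IsSolution G f x v → x 0 = x₀ → v 0 = v₀ →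
        (∀ t : ℝ, T ≤ t → ∀ i, HISO.output f (x t) (v t) i =
          (1 / (N : ℝ)) • ∑ j, gradient (f j) (x t j)) ∧
        (∀ i, Tendsto (fun t => x t i - (1 / (N : ℝ)) • ∑ j, x t j) atTop (𝓝 0)) := by
  have := hG.nonempty
  have hN : (N : ℝ) ≠ 0 := by exact_mod_cast (Classical.arbitrary (Fin N)).pos.ne'
  have hmean : ∀ w : HISO.Vec d, (1 / (N : ℝ)) • ∑ _j : Fin N, w = w := fun w => by
    rw [Finset.sum_const, Finset.card_univ, Fintype.card_fin, ← Nat.cast_smul_eq_nsmul ℝ,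
      smul_smul, one_div_mul_cancel hN, one_smul]
  have hT : 0 ≤ N * √(HISO.disagreement (HISO.output f x₀ v₀)) := by positivity
  refine ⟨_, hT, ?_⟩
  rintro x v h rfl rfl
  refine ⟨fun t ht i => ?_, fun i => ?_⟩
  · have hz := HISO.eq_of_disagreement_eq_zero (h.disagreement_output_eq_zero hG hf ht)
    have hv := h.sum_v_eq_zero hv₀ (hT.trans ht)
    have hsum : ∑ j, gradient (f j) (x t j) = ∑ j, HISO.output f (x t) (v t) j := by
      simp only [HISO.output, Finset.sum_add_distrib, hv, add_zero]
    rw [hsum, Finset.sum_congr rfl fun j _ => hz j i, hmean]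
  -- The deviation from the mean is the mean of the pairwise differences.
  · have hlim := (tendsto_finsetSum Finset.univ fun j _ =>
      h.tendsto_sub hG hf i j).const_smul (1 / (N : ℝ))
    rw [Finset.sum_const_zero, smul_zero] at hlim
    refine hlim.congr fun t => ?_
    rw [Finset.sum_sub_distrib, smul_sub, hmean]
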